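/- Let a node's state $X_t$ evolve as a Markov chain on a finite set $\mathcal S$ with transition matrix $\mathcal P=(p_{ij})$, with $n$-step probabilities $p_{ij}^{(n)}=(\mathcal P^n)_{ij}$, and let $X_0$ have an arbitrary law. In each slot $t=0,1,2,\dots$ a monitor either queries the state, at cost $c\ge 0$ and learning $X_t$, or predicts some $s_k$, suffering the (unobserved) loss $\ell_{jk}\ge 0$ if $X_t=s_j$. An online policy chooses the action, possibly at random, from its past actions and observations; $\Gamma(\pi)=\limsup_{T}\frac1T\sum_{t=0}^T\mathbb E[\text{cost in slot }t]$ is its sum average cost, and $\Gamma^\star=\inf_\pi\Gamma(\pi)$ over all online policies; $\pi$ is called optimal if $\Gamma(\pi)=\Gamma^\star$ and the time averages of $\pi$ converge. For positive integers $\mu=(\mu_i)$ the threshold policy $\pi_\mu$ queries at time $0$ and, whenever a query reveals $s_i$, queries again exactly $\mu_i$ slots later, predicting in between, $n$ slots after the query, a state $s_k$ that minimises $\sum_j p^{(n)}_{ij}\ell_{jk}$ (ties are broken arbitrarily). Let $$\mathbb E[\Lambda(s_i,m)]=c+\sum_{n=1}^{m-1}\min_k\sum_j p^{(n)}_{ij}\ell_{jk},\qquad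 V_{\gamma,h}(i,m)=\mathbb E[\Lambda(s_i,m)]-\gamma m+\sum_j p_{ij}^{(m)}h(s_j).$$ Fix $s_1\in\mathcal S$ and say that $(\gamma,h)$ evaluates $\mu$ if $h(s_i)=V_{\gamma,h}(i,\mu_i)$ for all $i$, and $h(s_1)=0$. A step of policy iteration from $\mu$ takes $(\gamma,h)$ evaluating $\mu$, and a $\mu'$ such that each $\mu'_i$ minimises $V_{\gamma,h}(i,\cdot)$ over the positive integers, with $\mu'_i=\mu_i$ if $\mu_i$ is already a minimiser. (a) If $(\Gamma^\star,h)$ evaluates $\mu$ for some $h$, that is, if $h(s_i)=\mathbb E[\Lambda(s_i,\mu_i)]-\Gamma^\star\mu_i+\sum_j p_{ij}^{(\mu_i)}h(s_j)$ for all $i$ and $h(s_1)=0$, then $\pi_\mu$ is optimal. (b) If $(\gamma,h)$ evaluates $\mu$, then the time-averaged expected cost of $\pi_\mu$ converges to $\gamma$. (c) If policy iteration stops at $\mu$, i.e. $(\gamma,h)$ evaluates $\mu$ and $\mu'=\mu$ is a possible result of the step, then $\gamma=\Gamma^\star$ and $\pi_\mu$ is optimal. (d) Suppose that for every choice of thresholds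 the chain of successively queried states (transition probabilities $p_{ij}^{(\mu_i)}$) can reach $s_1$ from every state. Then every $\mu$ is evaluated by exactly one $(\gamma,h)$, and no step of policy iteration increases $\Gamma(\pi_\mu)$. If, moreover, $\pi_\mu$ has a strictly smaller sum average cost than the policy that queries at time $0$ and then predicts optimally forever, then a step from $\mu$ exists. Every run of policy iteration from such a $\mu$ becomes constant after finitely many steps, at thresholds $\mu^\star$ for which the relative-cost recursion with cost rate $\Gamma^\star$ and $h(s_1)=0$ is solved by some $h$ such that each $\mu^\star_i$ minimises $V_{\Gamma^\star,h}(i,\cdot)$, and $\pi_{\mu^\star}$ is optimal. -/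

import Mathlib

open Filter Topology

open scoped NNReal

/-- A node whose state moves in `S` as a Markov chain, together with the prediction loss
`loss x k` (true state `x`, predicted state `k`) and the cost of one query. -/
structure MonitoringSystem (S : Type*) where
  /-- the law of the next state, given the current one -/
  step : S → PMF S
  /-- the loss matrix -/
  loss : S → S → ℝ≥0
  /-- the cost of a query -/
  queryCost : ℝ≥0

/-- What the monitor knows about a past slot: either it queried, and saw the state `x`,
or it predicted the state `k`, and saw nothing. -/
inductive Slot (S : Type*) where
  | queried (x : S) : Slot S
  | predicted (k : S) : Slot S

/-- An action of the monitor: `none` is a query, `some k` is the prediction of state `k`. -/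
abbrev MonitorAction (S : Type*) := Option S

/-- A (possibly randomized and history-dependent) online policy: the law of the next action as a
function of the observed history (the most recent slot is the head of the list). -/
abbrev OnlinePolicy (S : Type*) := List (Slot S) → PMF (MonitorAction S)

/-- The record of a slot in which the state was `x` and the action `a` was taken. -/
def Slot.record {S : Type*} (x : S) : MonitorAction S → Slot S
  | none => Slot.queried x
  | some k => Slot.predicted k

/-- The most recently queried state and the number of slots since that query, seen from the slot
that follows the given history; `none` if there has been no query yet. -/
def lastQuery {S : Type*} : List (Slot S) → Option (S × ℕ)
  | [] => none
  | Slot.queried x :: _ => some (x, 1)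
  | Slot.predicted _ :: H => (lastQuery H).map fun q => (q.1, q.2 + 1)

namespace MonitoringSystem

noncomputable section

variable {S : Type*} [Fintype S] [DecidableEq S] (M : MonitoringSystem S)

/-! ### Policies and their sum average cost -/

/-- The cost of a slot with state `x` and action `a`. -/
def slotCost (x : S) : MonitorAction S → ℝ
  | none => M.queryCost
  | some k => M.loss x k

/-- The joint law of the history before slot `t` and of the state `X_t`, under the policy `π`,
when `X_0` has law `ν`. -/
def historyLaw (π : OnlinePolicy S) (ν : PMF S) : ℕ → PMF (List (Slot S) × S)
  | 0 => ν.map fun x => ([], x)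
  | t + 1 => (historyLaw π ν t).bind fun z =>
      (π z.1).bind fun a => (M.step z.2).map fun y => (Slot.record z.2 a :: z.1, y)

/-- The joint law of the state and of the action in slot `t`. -/
def stateActionLaw (π : OnlinePolicy S) (ν : PMF S) (t : ℕ) : PMF (S × MonitorAction S) :=
  (M.historyLaw π ν t).bind fun z => (π z.1).map fun a => (z.2, a)

/-- The expected cost in slot `t`. -/
def expectedCost (π : OnlinePolicy S) (ν : PMF S) (t : ℕ) : ℝ :=
  ∑ x : S, ∑ a : MonitorAction S, (M.stateActionLaw π ν t (x, a)).toReal * M.slotCost x a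

/-- The time average of the expected costs up to time `T`. -/
def averageCost (π : OnlinePolicy S) (ν : PMF S) (T : ℕ) : ℝ :=
  (1 / (T : ℝ)) * ∑ t ∈ Finset.range (T + 1), M.expectedCost π ν t

/-- The sum average cost `Γ(π)`; the upper limit makes it meaningful for every policy. -/
def sumAverageCost (π : OnlinePolicy S) (ν : PMF S) : ℝ :=
  limsup (M.averageCost π ν) atTop

/-- The optimal sum average cost, over all online policies. -/
def optimalCost (ν : PMF S) : ℝ := ⨅ π : OnlinePolicy S, M.sumAverageCost π ν

/-- `π` is an optimal online policy: its time averages converge, and no online policy has a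
smaller sum average cost. -/
def IsOptimal (ν : PMF S) (π : OnlinePolicy S) : Prop :=
  Tendsto (M.averageCost π ν) atTop (𝓝 (M.sumAverageCost π ν)) ∧
    ∀ π' : OnlinePolicy S, M.sumAverageCost π ν ≤ M.sumAverageCost π' ν

/-! ### Predictions and threshold policies -/

/-- The transition matrix; the `n`-step transition probabilities are the entries of its powers. -/
def transitionMatrix : Matrix S S ℝ := Matrix.of fun i j => (M.step i j).toReal

/-- Expected loss of predicting `k`, `n` slots after the state `i` was queried. -/
def predictionLoss (i : S) (n : ℕ) (k : S) : ℝ :=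
  ∑ j : S, (M.transitionMatrix ^ n) i j * M.loss j k

/-- The prediction rule `κ` picks in each situation a state of least expected loss. -/
def IsOptimalPrediction (κ : S → ℕ → S) : Prop :=
  ∀ (i : S) (n : ℕ) (k : S), M.predictionLoss i n (κ i n) ≤ M.predictionLoss i n k

/-- The optimal expected prediction loss, `n` slots after the state `i` was queried. -/
def optimalLoss (i : S) (n : ℕ) : ℝ := ⨅ k : S, M.predictionLoss i n k

/-- The state-dependent threshold policy: query in slot `0`; after a query that reveals the state
`i`, query again exactly `μ i` slots later, and predict by the rule `κ` in between. -/
def thresholdPolicy (κ : S → ℕ → S) (μ : S → ℕ+) : OnlinePolicy S := fun H =>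
  match lastQuery H with
  | none => PMF.pure none
  | some (i, n) => if n = (μ i : ℕ) then PMF.pure none else PMF.pure (some (κ i n))

/-- The policy that queries in slot `0`, and then predicts by the rule `κ` forever. -/
def queryOncePolicy (κ : S → ℕ → S) : OnlinePolicy S := fun H =>
  match lastQuery H with
  | none => PMF.pure none
  | some (i, n) => PMF.pure (some (κ i n))

/-! ### Relative costs and policy iteration -/

/-- Expected total cost of a stage of `m` slots that starts with a query revealing `i`: one query,
followed by `m - 1` optimal predictions. -/
def stageCost (i : S) (m : ℕ+) : ℝ :=
  M.queryCost + ∑ n ∈ Finset.Ico 1 (m : ℕ), M.optimalLoss i n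

/-- The relative cost (with respect to the cost rate `γ`) of a stage of `m` slots starting in `i`,
plus the relative cost `h` from the next queried state on. -/
def stageValue (γ : ℝ) (h : S → ℝ) (i : S) (m : ℕ+) : ℝ :=
  M.stageCost i m - γ * (m : ℕ) + ∑ j : S, (M.transitionMatrix ^ (m : ℕ)) i j * h j

/-- The relative-cost recursion for the thresholds `μ` with cost rate `γ`, one equation for each
state, together with the normalisation at `s₁`. -/
def SolvesRelativeCost (s₁ : S) (μ : S → ℕ+) (γ : ℝ) (h : S → ℝ) : Prop :=
  (∀ i : S, h i = M.stageValue γ h i (μ i)) ∧ h s₁ = 0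

/-- Policy improvement: every new threshold minimises the stage value over all positive integers,
and an old threshold that is already a minimiser is kept. -/
def IsImprovement (γ : ℝ) (h : S → ℝ) (μ μ' : S → ℕ+) : Prop :=
  ∀ i : S, (∀ m : ℕ+, M.stageValue γ h i (μ' i) ≤ M.stageValue γ h i m) ∧
    ((∀ m : ℕ+, M.stageValue γ h i (μ i) ≤ M.stageValue γ h i m) → μ' i = μ i)

/-- One step of policy iteration: evaluate `μ` (solve for its cost rate and its relative costs),
then improve it to `μ'`. -/
def PolicyIterationStep (s₁ : S) (μ μ' : S → ℕ+) : Prop :=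
  ∃ (γ : ℝ) (h : S → ℝ), M.SolvesRelativeCost s₁ μ γ h ∧ M.IsImprovement γ h μ μ'

/-- Under every threshold policy, the chain of successively queried states can reach `s₁` from
every state. -/
def ReachesUnderAllThresholds (s₁ : S) : Prop :=
  ∀ (μ : S → ℕ+) (i : S),
    Relation.ReflTransGen (fun a b => 0 < (M.transitionMatrix ^ (μ a : ℕ)) a b) i s₁

end

end MonitoringSystem

/-! Predictions reveal nothing, so after a query of `i` the conditional law of the state depends
only on `i` and the age `n` of the query. `runningValue` is a potential on these pairs. If `h` lies
below every stage value, no action can beat the rate `γ` by more than the change of the potential,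
so `γ` is a lower bound for every online policy (`runningValue_le_totalCost`). For a threshold
policy evaluated by `(γ, h)` the same induction runs with equalities, up to a bounded error, so its
average cost tends to `γ` (`totalCost_abs_le`). Parts (a), (b) and (c) follow.

For (d), a minimum principle (`superharmonic_ge`) makes the evaluation equations uniquely solvable,
and comparing rates at a minimum (`rate_le`) shows that they never increase. Reachability under
constant thresholds makes the powers of the transition matrix converge to a matrix with equal rows.
Hence optimal losses tend to a limit `l`, which is the cost of querying once; a rate below `l` makes
stage values grow linearly, so minimisers exist.

Termination needs more, since there are infinitely many threshold vectors. A bound uniform in the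
thresholds (`exists_uniform_bound`) controls each growth of the relative costs by the drop of the
rate; these drops telescope, so the thresholds of a run stay bounded (`exists_threshold_le`). Some
vector then recurs, and recurrence forces a fixed point (`stops_of_repetition`). -/

set_option linter.unusedSectionVars false

/-! ### Averages against the rows of stochastic matrices -/

section Stochastic

variable {S : Type*} [Fintype S]

lemma PMF.toReal_bind_apply {α β : Type*} [Fintype α] (p : PMF α) (f : α → PMF β) (b : β) :
    (p.bind f b).toReal = ∑ a, (p a).toReal * (f a b).toReal := by
  rw [PMF.bind_apply, tsum_fintype, ENNReal.toReal_sum]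
  · simp [ENNReal.toReal_mul]
  · intro a _
    exact ENNReal.mul_ne_top (p.apply_ne_top a) ((f a).apply_ne_top b)

lemma PMF.sum_toReal {α : Type*} [Fintype α] (p : PMF α) : ∑ a, (p a).toReal = 1 := by
  rw [← ENNReal.toReal_sum fun a _ => p.apply_ne_top a, ← tsum_fintype (L := .unconditional α),
    p.tsum_coe, ENNReal.toReal_one]

lemma PMF.sum_toReal_bind_mul {α β : Type*} [Fintype α] [Fintype β] (p : PMF α) (f : α → PMF β)
    (g : β → ℝ) :
    ∑ b, (p.bind f b).toReal * g b = ∑ a, (p a).toReal * ∑ b, (f a b).toReal * g b := by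
  simp_rw [PMF.toReal_bind_apply, Finset.sum_mul, Finset.mul_sum, mul_assoc]
  exact Finset.sum_comm

lemma PMF.sum_toReal_map_mul {α β : Type*} [Fintype α] [Fintype β] (p : PMF α) (f : α → β)
    (g : β → ℝ) : ∑ b, (p.map f b).toReal * g b = ∑ a, (p a).toReal * g (f a) := by
  classical
  rw [← PMF.bind_pure_comp, PMF.sum_toReal_bind_mul]
  refine Finset.sum_congr rfl fun a _ => ?_
  congr 1
  rw [Finset.sum_eq_single (f a)]
  · simp
  · intro b _ hb
    simp [PMF.pure_apply, hb]
  · simp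

/-- A weighted mean is at most any upper bound of the averaged function. -/
lemma weightedMean_le {w f : S → ℝ} {C : ℝ} (hw : ∀ i, 0 ≤ w i) (hs : ∑ i, w i = 1)
    (hf : ∀ i, f i ≤ C) : ∑ i, w i * f i ≤ C :=
  calc ∑ i, w i * f i ≤ ∑ i, w i * C :=
        Finset.sum_le_sum fun i _ => mul_le_mul_of_nonneg_left (hf i) (hw i)
    _ = C := by rw [← Finset.sum_mul, hs, one_mul]

lemma le_weightedMean {w f : S → ℝ} {C : ℝ} (hw : ∀ i, 0 ≤ w i) (hs : ∑ i, w i = 1)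
    (hf : ∀ i, C ≤ f i) : C ≤ ∑ i, w i * f i :=
  calc C = ∑ i, w i * C := by rw [← Finset.sum_mul, hs, one_mul]
    _ ≤ ∑ i, w i * f i :=
        Finset.sum_le_sum fun i _ => mul_le_mul_of_nonneg_left (hf i) (hw i)

end Stochastic

namespace MonitoringSystem

variable {S : Type*} [Fintype S] [DecidableEq S] (M : MonitoringSystem S)

/-! ### Powers of the transition matrix and prediction losses. -/

lemma transitionMatrix_mem : M.transitionMatrix ∈ Matrix.rowStochastic ℝ S := by
  rw [Matrix.mem_rowStochastic_iff_sum]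
  exact ⟨fun i j => ENNReal.toReal_nonneg, fun i => PMF.sum_toReal (M.step i)⟩

lemma pow_apply_nonneg (n : ℕ) (i j : S) : 0 ≤ (M.transitionMatrix ^ n) i j :=
  Matrix.nonneg_of_mem_rowStochastic (pow_mem M.transitionMatrix_mem n)

lemma pow_sum_row (n : ℕ) (i : S) : ∑ j, (M.transitionMatrix ^ n) i j = 1 :=
  Matrix.sum_row_of_mem_rowStochastic (pow_mem M.transitionMatrix_mem n) i

lemma pow_mean_le (n : ℕ) (i : S) {f : S → ℝ} {C : ℝ} (hf : ∀ j, f j ≤ C) :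
    ∑ j, (M.transitionMatrix ^ n) i j * f j ≤ C :=
  weightedMean_le (M.pow_apply_nonneg n i) (M.pow_sum_row n i) hf

lemma le_pow_mean (n : ℕ) (i : S) {f : S → ℝ} {C : ℝ} (hf : ∀ j, C ≤ f j) :
    C ≤ ∑ j, (M.transitionMatrix ^ n) i j * f j :=
  le_weightedMean (M.pow_apply_nonneg n i) (M.pow_sum_row n i) hf

lemma pow_add_mean (m n : ℕ) (i : S) (f : S → ℝ) :
    ∑ x, (M.transitionMatrix ^ m) i x * ∑ y, (M.transitionMatrix ^ n) x y * f y =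
      ∑ y, (M.transitionMatrix ^ (m + n)) i y * f y := by
  simp_rw [pow_add, Matrix.mul_apply, Finset.sum_mul, Finset.mul_sum, mul_assoc]
  exact Finset.sum_comm

lemma pow_succ_mean (n : ℕ) (i : S) (f : S → ℝ) :
    ∑ x, (M.transitionMatrix ^ n) i x * ∑ y, (M.step x y).toReal * f y =
      ∑ y, (M.transitionMatrix ^ (n + 1)) i y * f y := by
  rw [← M.pow_add_mean n 1 i f]
  simp [transitionMatrix]

lemma pow_zero_mean (i : S) (f : S → ℝ) :
    ∑ x, (M.transitionMatrix ^ 0) i x * f x = f i := by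
  simp [Matrix.one_apply]

lemma pow_one_mean (i : S) (f : S → ℝ) :
    ∑ x, (M.transitionMatrix ^ 1) i x * f x = ∑ y, (M.step i y).toReal * f y := by
  simp [transitionMatrix]

lemma predictionLoss_nonneg (i : S) (n : ℕ) (k : S) : 0 ≤ M.predictionLoss i n k :=
  Finset.sum_nonneg fun j _ => mul_nonneg (M.pow_apply_nonneg n i j) (M.loss j k).coe_nonneg

lemma optimalLoss_le (i : S) (n : ℕ) (k : S) : M.optimalLoss i n ≤ M.predictionLoss i n k :=
  ciInf_le (Set.finite_range _).bddBelow k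

lemma optimalLoss_nonneg (i : S) (n : ℕ) : 0 ≤ M.optimalLoss i n :=
  Real.iInf_nonneg (M.predictionLoss_nonneg i n)

lemma IsOptimalPrediction.eq {M : MonitoringSystem S} {κ : S → ℕ → S}
    (hκ : M.IsOptimalPrediction κ) (i : S) (n : ℕ) :
    M.predictionLoss i n (κ i n) = M.optimalLoss i n :=
  have : Nonempty S := ⟨i⟩
  le_antisymm (le_ciInf (hκ i n)) (M.optimalLoss_le i n _)

/-! ### Total expected costs by forward recursion -/

noncomputable section

/-- The joint law of state and action `t` slots ahead, from a given history and state on. -/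
def stateActionLawFrom (π : OnlinePolicy S) : ℕ → List (Slot S) × S → PMF (S × MonitorAction S)
  | 0, z => (π z.1).map fun a => (z.2, a)
  | t + 1, z => (π z.1).bind fun a => (M.step z.2).bind fun y =>
      stateActionLawFrom π t (Slot.record z.2 a :: z.1, y)

/-- Expected total cost of the next `T` slots, from the history `H` and the state `x` on. -/
def totalCost (π : OnlinePolicy S) : ℕ → List (Slot S) → S → ℝ
  | 0, _, _ => 0
  | T + 1, H, x => ∑ a, (π H a).toReal * (M.slotCost x a +
      ∑ y, (M.step x y).toReal * totalCost π T (Slot.record x a :: H) y)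

end

/-- Moving the splitting time one slot back lengthens the look-ahead by one, so the induction on `t`
needs `s` arbitrary. This replaces a recursion over the last slot by one over the first. -/
lemma historyLaw_bind (π : OnlinePolicy S) (ν : PMF S) (s t : ℕ) :
    (M.historyLaw π ν t).bind (M.stateActionLawFrom π s) =
      ν.bind fun x => M.stateActionLawFrom π (s + t) ([], x) := by
  induction t generalizing s with
  | zero => simp [historyLaw, PMF.bind_map, Function.comp_def]
  | succ t ih =>
    rw [← add_assoc, add_right_comm, ← ih (s + 1)]
    simp [historyLaw, PMF.bind_bind, PMF.bind_map, stateActionLawFrom, Function.comp_def]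

lemma stateActionLaw_eq (π : OnlinePolicy S) (ν : PMF S) (t : ℕ) :
    M.stateActionLaw π ν t = ν.bind fun x => M.stateActionLawFrom π t ([], x) := by
  have := M.historyLaw_bind π ν 0 t
  rw [zero_add] at this
  rw [← this]
  rfl

lemma totalCost_eq_sum (π : OnlinePolicy S) (T : ℕ) (H : List (Slot S)) (x : S) :
    M.totalCost π T H x = ∑ t ∈ Finset.range T,
      ∑ q, (M.stateActionLawFrom π t (H, x) q).toReal * M.slotCost q.1 q.2 := by
  induction T generalizing H x with
  | zero => simp [totalCost]
  | succ T ih =>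
    rw [Finset.sum_range_succ', totalCost]
    simp_rw [ih, stateActionLawFrom, PMF.sum_toReal_bind_mul, PMF.sum_toReal_map_mul, mul_add,
      Finset.sum_add_distrib, Finset.mul_sum]
    rw [add_comm, Finset.sum_comm (s := Finset.range T)]
    refine congrArg₂ _ (Finset.sum_congr rfl fun a _ => ?_) rfl
    exact Finset.sum_comm

lemma sum_expectedCost (π : OnlinePolicy S) (ν : PMF S) (T : ℕ) :
    ∑ t ∈ Finset.range T, M.expectedCost π ν t =
      ∑ x, (ν x).toReal * M.totalCost π T [] x := by
  simp_rw [totalCost_eq_sum, Finset.mul_sum]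
  rw [Finset.sum_comm]
  refine Finset.sum_congr rfl fun t _ => ?_
  calc M.expectedCost π ν t
      = ∑ q, (M.stateActionLaw π ν t q).toReal * M.slotCost q.1 q.2 :=
        (Fintype.sum_prod_type
          fun q => (M.stateActionLaw π ν t q).toReal * M.slotCost q.1 q.2).symm
    _ = _ := by simp_rw [stateActionLaw_eq, PMF.sum_toReal_bind_mul, Finset.mul_sum]

/-- The expected costs after a query of `i`, when `n` slots have passed since. -/
lemma pow_mean_totalCost (π : OnlinePolicy S) (T : ℕ) (H : List (Slot S)) (i : S) (n : ℕ) :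
    ∑ x, (M.transitionMatrix ^ n) i x * M.totalCost π (T + 1) H x =
      (π H none).toReal * (M.queryCost + ∑ x, (M.transitionMatrix ^ n) i x *
        ∑ y, (M.transitionMatrix ^ 1) x y * M.totalCost π T (Slot.queried x :: H) y) +
      ∑ k, (π H (some k)).toReal * (M.predictionLoss i n k +
        ∑ y, (M.transitionMatrix ^ (n + 1)) i y * M.totalCost π T (Slot.predicted k :: H) y) := by
  have key : ∀ a : MonitorAction S,
      ∑ x, (M.transitionMatrix ^ n) i x * ((π H a).toReal * (M.slotCost x a +
        ∑ y, (M.step x y).toReal * M.totalCost π T (Slot.record x a :: H) y)) =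
      (π H a).toReal * (∑ x, (M.transitionMatrix ^ n) i x * M.slotCost x a +
        ∑ x, (M.transitionMatrix ^ n) i x *
          ∑ y, (M.step x y).toReal * M.totalCost π T (Slot.record x a :: H) y) := by
    intro a
    rw [← Finset.sum_add_distrib, Finset.mul_sum]
    exact Finset.sum_congr rfl fun x _ => by ring
  have hsum : ∑ x, (M.transitionMatrix ^ n) i x * M.totalCost π (T + 1) H x =
      ∑ a, ∑ x, (M.transitionMatrix ^ n) i x * ((π H a).toReal * (M.slotCost x a +
        ∑ y, (M.step x y).toReal * M.totalCost π T (Slot.record x a :: H) y)) := by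
    rw [Finset.sum_comm]
    refine Finset.sum_congr rfl fun x _ => ?_
    rw [totalCost, Finset.mul_sum]
  simp_rw [hsum, key]
  rw [Fintype.sum_option]
  simp_rw [pow_one_mean, Slot.record, slotCost, pow_succ_mean]
  rw [← Finset.sum_mul, M.pow_sum_row, one_mul]
  rfl

lemma pow_mean_totalCost_of_query {π : OnlinePolicy S} {H : List (Slot S)}
    (hπ : π H = PMF.pure none) (T : ℕ) (i : S) (n : ℕ) :
    ∑ x, (M.transitionMatrix ^ n) i x * M.totalCost π (T + 1) H x =
      M.queryCost + ∑ x, (M.transitionMatrix ^ n) i x *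
        ∑ y, (M.transitionMatrix ^ 1) x y * M.totalCost π T (Slot.queried x :: H) y := by
  rw [pow_mean_totalCost, hπ]
  simp [PMF.pure_apply]

lemma pow_mean_totalCost_of_predict {π : OnlinePolicy S} {H : List (Slot S)} {k : S}
    (hπ : π H = PMF.pure (some k)) (T : ℕ) (i : S) (n : ℕ) :
    ∑ x, (M.transitionMatrix ^ n) i x * M.totalCost π (T + 1) H x =
      M.predictionLoss i n k +
        ∑ y, (M.transitionMatrix ^ (n + 1)) i y * M.totalCost π T (Slot.predicted k :: H) y := by
  rw [pow_mean_totalCost, hπ]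
  simp [PMF.pure_apply, apply_ite ENNReal.toReal]

/-! ### Boundedness of costs and passage to time averages. -/

lemma slotCost_nonneg (x : S) (a : MonitorAction S) : 0 ≤ M.slotCost x a := by
  cases a <;> exact NNReal.coe_nonneg _

lemma expectedCost_nonneg (π : OnlinePolicy S) (ν : PMF S) (t : ℕ) : 0 ≤ M.expectedCost π ν t :=
  Finset.sum_nonneg fun x _ => Finset.sum_nonneg fun a _ =>
    mul_nonneg ENNReal.toReal_nonneg (M.slotCost_nonneg x a)

lemma exists_expectedCost_le : ∃ C : ℝ, 0 ≤ C ∧ ∀ (π : OnlinePolicy S) (ν : PMF S) (t : ℕ),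
    M.expectedCost π ν t ≤ C := by
  obtain ⟨C, hC⟩ := (Set.finite_range fun q : S × MonitorAction S =>
    M.slotCost q.1 q.2).bddAbove
  refine ⟨max C 0, le_max_right _ _, fun π ν t => ?_⟩
  have := weightedMean_le (w := fun q => (M.stateActionLaw π ν t q).toReal)
    (f := fun q : S × MonitorAction S => M.slotCost q.1 q.2) (C := C)
    (fun q => ENNReal.toReal_nonneg) (PMF.sum_toReal _) (fun q => hC ⟨q, rfl⟩)
  rw [Fintype.sum_prod_type] at this
  exact this.trans (le_max_left _ _)

/-- Without boundedness the real-valued `limsup` could be a default value. The factor `2` absorbs `T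
+ 1` slots being divided by `T`. -/
lemma exists_averageCost_le (π : OnlinePolicy S) (ν : PMF S) :
    ∃ C : ℝ, ∀ T, M.averageCost π ν T ≤ C := by
  obtain ⟨C, hC0, hC⟩ := M.exists_expectedCost_le
  refine ⟨2 * C, fun T => ?_⟩
  -- For `T = 0` the factor `1 / T` is zero, and so is the average.
  rcases T.eq_zero_or_pos with rfl | hT
  · simpa [averageCost] using hC0
  have h1 : ∑ t ∈ Finset.range (T + 1), M.expectedCost π ν t ≤ (T + 1 : ℝ) * C := by
    have := Finset.sum_le_card_nsmul (Finset.range (T + 1)) (M.expectedCost π ν) C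
      fun t _ => hC π ν t
    simpa using this
  have hT' : (1 : ℝ) ≤ T := by exact_mod_cast hT
  rw [averageCost, one_div, inv_mul_le_iff₀ (by positivity)]
  nlinarith

lemma tendsto_add_div (γ C : ℝ) :
    Tendsto (fun T : ℕ => (1 / (T : ℝ)) * (γ * (T + 1) + C)) atTop (𝓝 γ) := by
  have h : Tendsto (fun T : ℕ => γ + (γ + C) * (1 / (T : ℝ))) atTop (𝓝 (γ + (γ + C) * 0)) :=
    tendsto_const_nhds.add (tendsto_one_div_atTop_nhds_zero_nat.const_mul _)
  rw [mul_zero, add_zero] at h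
  refine h.congr' ?_
  filter_upwards [eventually_gt_atTop 0] with T hT
  have : (T : ℝ) ≠ 0 := by positivity
  field_simp
  ring

lemma le_sumAverageCost {π : OnlinePolicy S} {ν : PMF S} {γ C : ℝ}
    (h : ∀ T : ℕ, γ * T - C ≤ ∑ t ∈ Finset.range T, M.expectedCost π ν t) :
    γ ≤ M.sumAverageCost π ν := by
  obtain ⟨B, hB⟩ := M.exists_averageCost_le π ν
  rw [← (tendsto_add_div γ (-C)).limsup_eq]
  refine limsup_le_limsup (Eventually.of_forall fun T => ?_)
    (tendsto_add_div γ (-C)).isCoboundedUnder_le ⟨B, eventually_map.2 (Eventually.of_forall hB)⟩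
  refine mul_le_mul_of_nonneg_left ?_ (by positivity)
  have := h (T + 1)
  push_cast at this
  linarith

lemma tendsto_averageCost_of_abs_le {π : OnlinePolicy S} {ν : PMF S} {γ C : ℝ}
    (h : ∀ T : ℕ, |∑ t ∈ Finset.range (T + 1), M.expectedCost π ν t - γ * T| ≤ C) :
    Tendsto (M.averageCost π ν) atTop (𝓝 γ) := by
  refine tendsto_of_tendsto_of_tendsto_of_le_of_le (tendsto_add_div γ (-γ - C))
    (tendsto_add_div γ (-γ + C)) (fun T => ?_) (fun T => ?_) <;>
  · refine mul_le_mul_of_nonneg_left ?_ (by positivity)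
    have := abs_le.1 (h T)
    linarith

lemma optimalCost_le (ν : PMF S) (π : OnlinePolicy S) :
    M.optimalCost ν ≤ M.sumAverageCost π ν := by
  refine ciInf_le ⟨0, ?_⟩ π
  rintro _ ⟨π', rfl⟩
  refine M.le_sumAverageCost (C := 0) fun T => ?_
  simpa using Finset.sum_nonneg fun t _ => M.expectedCost_nonneg π' ν t

lemma isOptimal_of_tendsto {ν : PMF S} {π : OnlinePolicy S}
    (h : Tendsto (M.averageCost π ν) atTop (𝓝 (M.optimalCost ν))) : M.IsOptimal ν π := by
  have : M.sumAverageCost π ν = M.optimalCost ν := h.limsup_eq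
  exact ⟨this ▸ h, fun π' => this ▸ M.optimalCost_le ν π'⟩

/-! ### The relative cost as a potential -/

/-- The relative cost that remains `n` slots after a query of `i`, before the next query. -/
noncomputable def runningValue (γ : ℝ) (h : S → ℝ) (i : S) (n : ℕ) : ℝ :=
  h i - M.queryCost - ∑ k ∈ Finset.Ico 1 n, M.optimalLoss i k + γ * n

lemma runningValue_one (γ : ℝ) (h : S → ℝ) (i : S) :
    M.runningValue γ h i 1 = h i - M.queryCost + γ := by
  simp [runningValue]

lemma runningValue_succ (γ : ℝ) (h : S → ℝ) (i : S) {n : ℕ} (hn : 1 ≤ n) :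
    M.runningValue γ h i (n + 1) = M.runningValue γ h i n - M.optimalLoss i n + γ := by
  rw [runningValue, runningValue, Finset.sum_Ico_succ_top hn]
  push_cast
  ring

lemma stageValue_eq (γ : ℝ) (h : S → ℝ) (i : S) (m : ℕ+) :
    M.stageValue γ h i m =
      h i - M.runningValue γ h i m + ∑ j, (M.transitionMatrix ^ (m : ℕ)) i j * h j := by
  rw [stageValue, stageCost, runningValue]
  ring

/-- A cost rate whose relative costs are at most the value of every stage is a lower bound for the
costs of every policy. -/
lemma runningValue_le_totalCost {γ C : ℝ} {h : S → ℝ}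
    (hV : ∀ i (m : ℕ+), h i ≤ M.stageValue γ h i m) (hC : ∀ i, h i ≤ C) (π : OnlinePolicy S)
    (T : ℕ) (H : List (Slot S)) (i : S) (n : ℕ) (hn : 1 ≤ n) :
    γ * T + M.runningValue γ h i n - C ≤
      ∑ x, (M.transitionMatrix ^ n) i x * M.totalCost π T H x := by
  -- This is `hV` for the stage that ends at age `n`: a query now does not lower the expected
  -- potential.
  have hD : ∀ i n, 1 ≤ n →
      M.runningValue γ h i n ≤ ∑ j, (M.transitionMatrix ^ n) i j * h j := by
    intro i n hn
    have := (hV i ⟨n, hn⟩).trans_eq (M.stageValue_eq γ h i ⟨n, hn⟩)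
    simp only [PNat.mk_coe] at this
    linarith
  -- A query restarts the pair at `(x, 1)`, a prediction moves it to `(i, n + 1)`; `H` only
  -- determines the action probabilities and need not record the query of `i`.
  induction T generalizing H i n with
  | zero =>
    have := (hD i n hn).trans (M.pow_mean_le n i hC)
    simp only [totalCost, mul_zero, Finset.sum_const_zero, Nat.cast_zero]
    linarith
  | succ T ih =>
    rw [pow_mean_totalCost]
    have hq : γ * (T + 1 : ℕ) + M.runningValue γ h i n - C ≤
        M.queryCost + ∑ x, (M.transitionMatrix ^ n) i x *
          ∑ y, (M.transitionMatrix ^ 1) x y * M.totalCost π T (Slot.queried x :: H) y := by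
      have h1 : ∑ x, (M.transitionMatrix ^ n) i x * (h x + (γ * T - M.queryCost + γ - C)) ≤
          ∑ x, (M.transitionMatrix ^ n) i x *
            ∑ y, (M.transitionMatrix ^ 1) x y * M.totalCost π T (Slot.queried x :: H) y := by
        refine Finset.sum_le_sum fun x _ => mul_le_mul_of_nonneg_left ?_ (M.pow_apply_nonneg n i x)
        refine le_trans (le_of_eq ?_) (ih (Slot.queried x :: H) x 1 le_rfl)
        rw [runningValue_one]
        ring
      simp_rw [mul_add, Finset.sum_add_distrib] at h1
      rw [← Finset.sum_mul, M.pow_sum_row] at h1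
      have := hD i n hn
      push_cast
      linarith
    have hp : ∀ k, γ * (T + 1 : ℕ) + M.runningValue γ h i n - C ≤ M.predictionLoss i n k +
        ∑ y, (M.transitionMatrix ^ (n + 1)) i y * M.totalCost π T (Slot.predicted k :: H) y := by
      intro k
      have h1 := ih (Slot.predicted k :: H) i (n + 1) (by omega)
      rw [runningValue_succ _ _ _ _ hn] at h1
      have := M.optimalLoss_le i n k
      push_cast
      linarith
    have hsum := PMF.sum_toReal (π H)
    rw [Fintype.sum_option] at hsum
    calc γ * (T + 1 : ℕ) + M.runningValue γ h i n - C
        = (π H none).toReal * (γ * (T + 1 : ℕ) + M.runningValue γ h i n - C) +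
          ∑ k, (π H (some k)).toReal * (γ * (T + 1 : ℕ) + M.runningValue γ h i n - C) := by
          rw [← Finset.sum_mul, ← add_mul, hsum, one_mul]
      _ ≤ _ := add_le_add (mul_le_mul_of_nonneg_left hq ENNReal.toReal_nonneg)
          (Finset.sum_le_sum fun k _ => mul_le_mul_of_nonneg_left (hp k) ENNReal.toReal_nonneg)

lemma le_sumAverageCost_of_le_stageValue {γ : ℝ} {h : S → ℝ}
    (hV : ∀ i (m : ℕ+), h i ≤ M.stageValue γ h i m) (π : OnlinePolicy S) (ν : PMF S) :
    γ ≤ M.sumAverageCost π ν := by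
  obtain ⟨C, hC⟩ := (Set.finite_range h).bddAbove
  obtain ⟨B, hB⟩ := (Set.finite_range h).bddBelow
  have hC' : ∀ i, h i ≤ C := fun i => hC ⟨i, rfl⟩
  -- The first action is only bounded from below by zero: the state is not known yet.
  have hstart : ∀ T x, γ * T + (B - M.queryCost + γ - C) ≤ M.totalCost π (T + 1) [] x := by
    intro T x
    rw [totalCost]
    refine le_weightedMean (fun a => ENNReal.toReal_nonneg) (PMF.sum_toReal _) fun a => ?_
    -- This applies even if the first action was a prediction: conditioning on the initial state `x`
    -- gives the next state the law of row `x`, whatever the history shows.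
    have h1 := M.runningValue_le_totalCost hV hC' π T [Slot.record x a] x 1 le_rfl
    rw [pow_one_mean, runningValue_one] at h1
    have h2 := M.slotCost_nonneg x a
    have h3 : B ≤ h x := hB ⟨x, rfl⟩
    linarith
  refine M.le_sumAverageCost (C := |γ| + |B - M.queryCost + γ - C|) fun T => ?_
  rcases T with _ | T
  · simp only [Nat.cast_zero, mul_zero, Finset.range_zero, Finset.sum_empty]
    have := abs_nonneg γ
    have := abs_nonneg (B - M.queryCost + γ - C)
    linarith
  rw [sum_expectedCost]
  refine le_trans ?_ (le_weightedMean (fun a => ENNReal.toReal_nonneg) (PMF.sum_toReal ν)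
    (hstart T))
  have := neg_abs_le (B - M.queryCost + γ - C)
  have := le_abs_self γ
  push_cast
  linarith

/-! ### Threshold policies -/

/-- Each slot preserves the potential exactly: predictions are optimal and queries come when the
evaluation equation holds. Only the terminal error at `T = 0` remains, and averaging does not
enlarge it. -/
lemma totalCost_abs_le {κ : S → ℕ → S} (hκ : M.IsOptimalPrediction κ) {μ : S → ℕ+} {γ C : ℝ}
    {h : S → ℝ} (hV : ∀ i, h i = M.stageValue γ h i (μ i))
    (hC : ∀ i, ∀ n ≤ (μ i : ℕ), |M.runningValue γ h i n| ≤ C) (T : ℕ) (H : List (Slot S)) (i : S)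
    (n : ℕ) (hH : lastQuery H = some (i, n)) (hn : 1 ≤ n) (hn' : n ≤ μ i) :
    |∑ x, (M.transitionMatrix ^ n) i x * M.totalCost (thresholdPolicy κ μ) T H x -
      (γ * T + M.runningValue γ h i n)| ≤ C := by
  induction T generalizing H i n with
  | zero => simpa [totalCost] using hC i n hn'
  | succ T ih =>
    by_cases hm : n = μ i
    · have hπ : thresholdPolicy κ μ H = PMF.pure none := by simp [thresholdPolicy, hH, hm]
      have hD : M.runningValue γ h i n = ∑ j, (M.transitionMatrix ^ n) i j * h j := by
        have := hV i
        rw [stageValue_eq, ← hm] at this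
        linarith
      rw [M.pow_mean_totalCost_of_query hπ]
      have h1 : ∀ x, |∑ y, (M.transitionMatrix ^ 1) x y *
          M.totalCost (thresholdPolicy κ μ) T (Slot.queried x :: H) y -
          (γ * T + (h x - M.queryCost + γ))| ≤ C := by
        intro x
        have := ih (Slot.queried x :: H) x 1 rfl le_rfl (μ x).pos
        rwa [runningValue_one] at this
      have h2 : (M.queryCost + ∑ x, (M.transitionMatrix ^ n) i x * ∑ y,
            (M.transitionMatrix ^ 1) x y *
              M.totalCost (thresholdPolicy κ μ) T (Slot.queried x :: H) y) -
          (γ * (T + 1 : ℕ) + M.runningValue γ h i n) =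
          ∑ x, (M.transitionMatrix ^ n) i x * (∑ y, (M.transitionMatrix ^ 1) x y *
            M.totalCost (thresholdPolicy κ μ) T (Slot.queried x :: H) y -
            (γ * T + (h x - M.queryCost + γ))) := by
        simp_rw [mul_sub, mul_add, mul_sub, Finset.sum_sub_distrib, Finset.sum_add_distrib,
          Finset.sum_sub_distrib, ← Finset.sum_mul, M.pow_sum_row, hD]
        push_cast
        ring
      rw [h2, abs_le]
      exact ⟨M.le_pow_mean n i fun x => (abs_le.1 (h1 x)).1,
        M.pow_mean_le n i fun x => (abs_le.1 (h1 x)).2⟩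
    · have hπ : thresholdPolicy κ μ H = PMF.pure (some (κ i n)) := by
        simp [thresholdPolicy, hH, hm]
      have h1 := ih (Slot.predicted (κ i n) :: H) i (n + 1) (by simp [lastQuery, hH]) (by omega)
        (by omega)
      rw [runningValue_succ _ _ _ _ hn] at h1
      rw [M.pow_mean_totalCost_of_predict hπ, hκ.eq]
      convert h1 using 2
      push_cast
      ring

lemma tendsto_averageCost_thresholdPolicy {κ : S → ℕ → S} (hκ : M.IsOptimalPrediction κ)
    (ν : PMF S) {s₁ : S} {μ : S → ℕ+} {γ : ℝ} {h : S → ℝ}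
    (hV : M.SolvesRelativeCost s₁ μ γ h) :
    Tendsto (M.averageCost (thresholdPolicy κ μ) ν) atTop (𝓝 γ) := by
  have hfin : (⋃ i, (fun n => |M.runningValue γ h i n|) '' Set.Iic (μ i : ℕ)).Finite :=
    Set.finite_iUnion fun i => (Set.finite_Iic _).image _
  obtain ⟨C, hC⟩ := hfin.bddAbove
  have hC' : ∀ i, ∀ n ≤ (μ i : ℕ), |M.runningValue γ h i n| ≤ C := fun i n hn =>
    hC (Set.mem_iUnion.2 ⟨i, n, hn, rfl⟩)
  have hstart : ∀ T x, |M.totalCost (thresholdPolicy κ μ) (T + 1) [] x - γ * T| ≤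
      C + C + M.queryCost := by
    intro T x
    have h1 := M.totalCost_abs_le hκ hV.1 hC' T [Slot.queried x] x 1 rfl le_rfl (μ x).pos
    have h2 := hC' x 1 (μ x).pos
    have h3 := M.pow_zero_mean x (M.totalCost (thresholdPolicy κ μ) (T + 1) [])
    have hπ : thresholdPolicy κ μ [] = PMF.pure none := rfl
    rw [M.pow_mean_totalCost_of_query hπ, pow_zero_mean] at h3
    rw [← h3]
    have := M.queryCost.coe_nonneg
    rw [abs_le] at h1 h2 ⊢
    constructor <;> linarith
  refine M.tendsto_averageCost_of_abs_le (C := C + C + M.queryCost) fun T => ?_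
  have h1 : ∑ t ∈ Finset.range (T + 1), M.expectedCost (thresholdPolicy κ μ) ν t - γ * T =
      ∑ x, (ν x).toReal * (M.totalCost (thresholdPolicy κ μ) (T + 1) [] x - γ * T) := by
    simp_rw [sum_expectedCost, mul_sub, Finset.sum_sub_distrib, ← Finset.sum_mul, PMF.sum_toReal,
      one_mul]
  rw [h1, abs_le]
  exact ⟨le_weightedMean (fun _ => ENNReal.toReal_nonneg) (PMF.sum_toReal ν)
      fun x => (abs_le.1 (hstart T x)).1,
    weightedMean_le (fun _ => ENNReal.toReal_nonneg) (PMF.sum_toReal ν)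
      fun x => (abs_le.1 (hstart T x)).2⟩

lemma sumAverageCost_thresholdPolicy {κ : S → ℕ → S} (hκ : M.IsOptimalPrediction κ)
    (ν : PMF S) {s₁ : S} {μ : S → ℕ+} {γ : ℝ} {h : S → ℝ}
    (hV : M.SolvesRelativeCost s₁ μ γ h) : M.sumAverageCost (thresholdPolicy κ μ) ν = γ :=
  (M.tendsto_averageCost_thresholdPolicy hκ ν hV).limsup_eq

lemma optimal_of_isImprovement_self {κ : S → ℕ → S} (hκ : M.IsOptimalPrediction κ)
    (ν : PMF S) {s₁ : S} {μ : S → ℕ+} {γ : ℝ} {h : S → ℝ}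
    (hV : M.SolvesRelativeCost s₁ μ γ h) (hI : M.IsImprovement γ h μ μ) :
    γ = M.optimalCost ν ∧ M.IsOptimal ν (thresholdPolicy κ μ) := by
  have hγ : γ = M.optimalCost ν := by
    refine le_antisymm (le_ciInf fun π => M.le_sumAverageCost_of_le_stageValue (h := h)
      (fun i m => (hV.1 i).trans_le ((hI i).1 m)) π ν) ?_
    rw [← M.sumAverageCost_thresholdPolicy hκ ν hV]
    exact M.optimalCost_le ν _
  exact ⟨hγ, M.isOptimal_of_tendsto (hγ ▸ M.tendsto_averageCost_thresholdPolicy hκ ν hV)⟩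

/-! ### Policy evaluation and improvement -/

section Evaluation

variable {M} {s₁ : S} {μ : S → ℕ+}

/-- At a minimum of `g` the mean is at least `g i`, which leaves `0 ≤ δ * μ i`. -/
lemma rate_nonneg_of_superharmonic [Nonempty S] {δ : ℝ} {g : S → ℝ}
    (hg : ∀ i, ∑ j, (M.transitionMatrix ^ (μ i : ℕ)) i j * g j - δ * (μ i : ℕ) ≤ g i) :
    0 ≤ δ := by
  obtain ⟨i, hi⟩ := Finite.exists_min g
  have h1 := M.le_pow_mean (μ i) i hi
  have h2 := hg i
  have h3 : (0 : ℝ) < (μ i : ℕ) := by exact_mod_cast (μ i).pos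
  by_contra! h
  nlinarith

/-- Minimum principle: the minimum passes along every edge of positive probability, hence to `s₁`.
-/
lemma superharmonic_ge (hs : M.ReachesUnderAllThresholds s₁) {g : S → ℝ}
    (hg : ∀ i, ∑ j, (M.transitionMatrix ^ (μ i : ℕ)) i j * g j ≤ g i) (i : S) :
    g s₁ ≤ g i := by
  have : Nonempty S := ⟨i⟩
  obtain ⟨i₀, h₀⟩ := Finite.exists_min g
  refine le_trans ?_ (h₀ i)
  have hr := hs μ i₀
  clear hs
  induction hr with
  | refl => exact le_rfl
  | @tail a b _ hab ih =>
    by_contra! hb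
    have h1 : 0 < ∑ j, (M.transitionMatrix ^ (μ a : ℕ)) a j * (g j - g i₀) :=
      Finset.sum_pos' (fun j _ => mul_nonneg (M.pow_apply_nonneg _ _ _) (sub_nonneg.2 (h₀ j)))
        ⟨b, Finset.mem_univ b, mul_pos hab (sub_pos.2 hb)⟩
    simp_rw [mul_sub, Finset.sum_sub_distrib, ← Finset.sum_mul, M.pow_sum_row, one_mul] at h1
    linarith [hg a]

/-- The stage costs cancel on subtraction, which opens comparisons of rates and relative costs to
the minimum principle. -/
lemma sub_superharmonic {γ γ' : ℝ} {h h' : S → ℝ}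
    (hV : ∀ i, M.stageValue γ h i (μ i) ≤ h i) (hV' : ∀ i, h' i ≤ M.stageValue γ' h' i (μ i))
    (i : S) : ∑ j, (M.transitionMatrix ^ (μ i : ℕ)) i j * (h j - h' j) -
      (γ - γ') * (μ i : ℕ) ≤ h i - h' i := by
  have h1 := hV i
  have h2 := hV' i
  simp_rw [mul_sub, Finset.sum_sub_distrib]
  rw [stageValue] at h1 h2
  linarith

lemma rate_le {γ γ' : ℝ} {h h' : S → ℝ} (hV : ∀ i, M.stageValue γ h i (μ i) ≤ h i)
    (hV' : M.SolvesRelativeCost s₁ μ γ' h') : γ' ≤ γ := by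
  have : Nonempty S := ⟨s₁⟩
  exact sub_nonneg.1 (rate_nonneg_of_superharmonic (sub_superharmonic hV fun i => (hV'.1 i).le))

lemma relativeCost_le (hs : M.ReachesUnderAllThresholds s₁) {γ : ℝ} {h h' : S → ℝ}
    (hV : ∀ i, M.stageValue γ h i (μ i) ≤ h i) (h0 : h s₁ = 0)
    (hV' : M.SolvesRelativeCost s₁ μ γ h') (i : S) : h' i ≤ h i := by
  have h1 := superharmonic_ge hs (g := fun j => h j - h' j) (μ := μ) (fun i => by
    have := sub_superharmonic hV (fun i => (hV'.1 i).le) i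
    simpa using this) i
  simp only [h0, hV'.2] at h1
  linarith

lemma solution_unique (hs : M.ReachesUnderAllThresholds s₁) {γ γ' : ℝ} {h h' : S → ℝ}
    (hV : M.SolvesRelativeCost s₁ μ γ h) (hV' : M.SolvesRelativeCost s₁ μ γ' h') :
    γ = γ' ∧ h = h' := by
  obtain rfl : γ = γ' := le_antisymm (rate_le (fun i => (hV'.1 i).ge) hV)
    (rate_le (fun i => (hV.1 i).ge) hV')
  exact ⟨rfl, funext fun i => le_antisymm (relativeCost_le hs (fun i => (hV'.1 i).ge) hV'.2 hV i)
    (relativeCost_le hs (fun i => (hV.1 i).ge) hV.2 hV' i)⟩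

/-- The linear system is square, so a trivial kernel suffices; for a kernel element the minimum
principle is applied to `g` and to `-g`. -/
lemma exists_solution (hs : M.ReachesUnderAllThresholds s₁) (μ : S → ℕ+) :
    ∃ (γ : ℝ) (h : S → ℝ), M.SolvesRelativeCost s₁ μ γ h := by
  have : Nonempty S := ⟨s₁⟩
  let L : (ℝ × (S → ℝ)) →ₗ[ℝ] ((S → ℝ) × ℝ) :=
    { toFun := fun p => (fun i => p.2 i + p.1 * (μ i : ℕ) -
        ∑ j, (M.transitionMatrix ^ (μ i : ℕ)) i j * p.2 j, p.2 s₁)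
      map_add' := fun p q => by
        ext i
        · simp only [Prod.fst_add, Prod.snd_add, Pi.add_apply, mul_add, Finset.sum_add_distrib]
          ring
        · simp
      map_smul' := fun c p => by
        ext i
        · simp only [Prod.smul_fst, Prod.smul_snd, Pi.smul_apply, smul_eq_mul, RingHom.id_apply,
            mul_sub, Finset.mul_sum, mul_left_comm _ c]
          ring
        · simp }
  have hinj : Function.Injective L := by
    rw [injective_iff_map_eq_zero]
    rintro ⟨δ, g⟩ hL
    have hg : ∀ i, g i = ∑ j, (M.transitionMatrix ^ (μ i : ℕ)) i j * g j - δ * (μ i : ℕ) := by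
      intro i
      have : g i + δ * (μ i : ℕ) - ∑ j, (M.transitionMatrix ^ (μ i : ℕ)) i j * g j = 0 :=
        congrFun (congrArg Prod.fst hL) i
      linarith
    have hg1 : g s₁ = 0 := congrArg Prod.snd hL
    have hn : ∀ i, ∑ j, (M.transitionMatrix ^ (μ i : ℕ)) i j * (-g j) - (-δ) * (μ i : ℕ) =
        -g i := by
      intro i
      simp only [mul_neg, Finset.sum_neg_distrib]
      linarith [hg i]
    obtain rfl : δ = 0 := le_antisymm
      (neg_nonneg.1 (rate_nonneg_of_superharmonic (g := fun j => -g j) fun i => (hn i).le))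
      (rate_nonneg_of_superharmonic fun i => (hg i).ge)
    have h1 := superharmonic_ge hs (g := g) (μ := μ) fun i => by simpa using (hg i).ge
    have h2 := superharmonic_ge hs (g := fun j => -g j) (μ := μ) fun i => by
      simpa using (hn i).le
    refine Prod.ext rfl (funext fun i => ?_)
    have h3 := h1 i
    have h4 := h2 i
    simp only [hg1, neg_zero, Left.nonneg_neg_iff] at h3 h4
    exact le_antisymm h4 h3
  have hsurj : Function.Surjective L :=
    (LinearMap.injective_iff_surjective_of_finrank_eq_finrank (by simp [add_comm])).1 hinj
  obtain ⟨⟨γ, h⟩, hp⟩ := hsurj (fun i => M.stageCost i (μ i), 0)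
  refine ⟨γ, h, fun i => ?_, congrArg Prod.snd hp⟩
  have : h i + γ * (μ i : ℕ) - ∑ j, (M.transitionMatrix ^ (μ i : ℕ)) i j * h j =
      M.stageCost i (μ i) := congrFun (congrArg Prod.fst hp) i
  rw [stageValue]
  linarith

lemma IsImprovement.stageValue_le {γ : ℝ} {h : S → ℝ} {μ' : S → ℕ+}
    (hI : M.IsImprovement γ h μ μ') (hV : M.SolvesRelativeCost s₁ μ γ h) (i : S) :
    M.stageValue γ h i (μ' i) ≤ h i :=
  ((hI i).1 (μ i)).trans (hV.1 i).ge

end Evaluation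

/-! ### Convergence to the stationary law -/

section Ergodic

variable {M} {s₁ : S}

lemma pow_pos_trans {m n : ℕ} {i j k : S} (hij : 0 < (M.transitionMatrix ^ m) i j)
    (hjk : 0 < (M.transitionMatrix ^ n) j k) : 0 < (M.transitionMatrix ^ (m + n)) i k := by
  rw [pow_add, Matrix.mul_apply]
  exact Finset.sum_pos' (fun x _ => mul_nonneg (M.pow_apply_nonneg _ _ _)
    (M.pow_apply_nonneg _ _ _)) ⟨j, Finset.mem_univ j, mul_pos hij hjk⟩

/-- Constant thresholds `d` give walks whose length is a multiple of `d`; this rules out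
periodicity. -/
lemma exists_pow_mul_pos (hs : M.ReachesUnderAllThresholds s₁) (d : ℕ+) (i : S) :
    ∃ k : ℕ, 0 < (M.transitionMatrix ^ ((d : ℕ) * k)) i s₁ := by
  induction hs (fun _ => d) i using Relation.ReflTransGen.head_induction_on with
  | refl => exact ⟨0, by simp⟩
  | head hab _ ih =>
    obtain ⟨k, hk⟩ := ih
    exact ⟨k + 1, by rw [mul_add, mul_one, add_comm]; exact pow_pos_trans hab hk⟩

/-- Some power of the transition matrix has a positive column at `s₁`. -/
lemma exists_pow_pos (hs : M.ReachesUnderAllThresholds s₁) :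
    ∃ N : ℕ+, ∀ i, 0 < (M.transitionMatrix ^ (N : ℕ)) i s₁ := by
  -- `d` is the length of a closed walk at `s₁`; taking one step away first makes it positive.
  obtain ⟨d, hd⟩ : ∃ d : ℕ+, 0 < (M.transitionMatrix ^ (d : ℕ)) s₁ s₁ := by
    obtain ⟨j, -, hj⟩ : ∃ j ∈ Finset.univ, 0 < (M.transitionMatrix ^ 1) s₁ j := by
      refine Finset.exists_lt_of_sum_lt ?_
      rw [Finset.sum_const_zero, M.pow_sum_row]
      exact one_pos
    obtain ⟨k, hk⟩ := exists_pow_mul_pos hs 1 j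
    exact ⟨⟨1 + (1 : ℕ+) * k, by omega⟩, pow_pos_trans hj hk⟩
  have hloop : ∀ r : ℕ, 0 < (M.transitionMatrix ^ ((d : ℕ) * r)) s₁ s₁ := by
    intro r
    induction r with
    | zero => simp
    | succ r ih => rw [mul_add, mul_one]; exact pow_pos_trans ih hd
  choose k hk using exists_pow_mul_pos hs d
  -- Walks of length `d * k i` are padded with loops at `s₁` to a common length.
  refine ⟨⟨(d : ℕ) * (∑ i, k i + 1), by positivity⟩, fun i => ?_⟩
  have hle : k i ≤ ∑ i, k i := Finset.single_le_sum (fun _ _ => Nat.zero_le _) (Finset.mem_univ i)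
  have := pow_pos_trans (hk i) (hloop (∑ i, k i + 1 - k i))
  rwa [← mul_add, show k i + (∑ i, k i + 1 - k i) = ∑ i, k i + 1 by omega] at this

lemma pow_add_apply (m n : ℕ) (i j : S) : (M.transitionMatrix ^ (m + n)) i j =
    ∑ x, (M.transitionMatrix ^ m) i x * (M.transitionMatrix ^ n) x j := by
  rw [pow_add, Matrix.mul_apply]

/-- The entries of a column of the powers of a transition matrix satisfying Doeblin's condition
lie in intervals that shrink geometrically. -/
lemma exists_interval {N : ℕ} {δ : ℝ} (hδ : ∀ i, δ ≤ (M.transitionMatrix ^ N) i s₁) (j : S)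
    (k : ℕ) : ∃ a b : ℝ, b - a ≤ (1 - δ) ^ k ∧ ∀ n, N * k ≤ n → ∀ i,
      a ≤ (M.transitionMatrix ^ n) i j ∧ (M.transitionMatrix ^ n) i j ≤ b := by
  have hδ1 : 0 ≤ 1 - δ := by
    have := (hδ s₁).trans (Matrix.le_one_of_mem_rowStochastic
      (pow_mem M.transitionMatrix_mem N))
    linarith
  induction k with
  | zero =>
    exact ⟨0, 1, by simp, fun n _ i => ⟨M.pow_apply_nonneg n i j,
      Matrix.le_one_of_mem_rowStochastic (pow_mem M.transitionMatrix_mem n)⟩⟩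
  | succ k ih =>
    obtain ⟨a, b, hab, h⟩ := ih
    set f := fun x => (M.transitionMatrix ^ (N * k)) x j with hf
    have hfab : ∀ x, a ≤ f x ∧ f x ≤ b := h (N * k) le_rfl
    -- Every row of the `N`-th power gives `s₁` weight at least `δ`, so all new values share the
    -- part `δ * f s₁`.
    refine ⟨δ * f s₁ + (1 - δ) * a, δ * f s₁ + (1 - δ) * b, ?_, ?_⟩
    · rw [pow_succ]
      nlinarith
    have hN : ∀ i, δ * f s₁ + (1 - δ) * a ≤ (M.transitionMatrix ^ (N + N * k)) i j ∧
        (M.transitionMatrix ^ (N + N * k)) i j ≤ δ * f s₁ + (1 - δ) * b := by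
      intro i
      have hsum := M.pow_sum_row N i
      have hlow : (M.transitionMatrix ^ N) i s₁ * (f s₁ - a) ≤
          ∑ x, (M.transitionMatrix ^ N) i x * (f x - a) :=
        Finset.single_le_sum (f := fun x => (M.transitionMatrix ^ N) i x * (f x - a))
          (fun x _ => mul_nonneg (M.pow_apply_nonneg _ _ _) (sub_nonneg.2 (hfab x).1))
          (Finset.mem_univ s₁)
      have hupp : (M.transitionMatrix ^ N) i s₁ * (b - f s₁) ≤
          ∑ x, (M.transitionMatrix ^ N) i x * (b - f x) :=
        Finset.single_le_sum (f := fun x => (M.transitionMatrix ^ N) i x * (b - f x))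
          (fun x _ => mul_nonneg (M.pow_apply_nonneg _ _ _) (sub_nonneg.2 (hfab x).2))
          (Finset.mem_univ s₁)
      simp_rw [mul_sub, Finset.sum_sub_distrib, ← Finset.sum_mul, hsum] at hlow hupp
      have h1 := mul_le_mul_of_nonneg_right (hδ i) (sub_nonneg.2 (hfab s₁).1)
      have h2 := mul_le_mul_of_nonneg_right (hδ i) (sub_nonneg.2 (hfab s₁).2)
      rw [pow_add_apply]
      constructor <;> linarith
    intro n hn i
    obtain ⟨r, rfl⟩ := Nat.exists_eq_add_of_le hn
    rw [show N * (k + 1) + r = r + (N + N * k) by ring, pow_add_apply]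
    exact ⟨M.le_pow_mean r i fun x => (hN x).1, M.pow_mean_le r i fun x => (hN x).2⟩

/-- The intervals of `exists_interval` contain the entries of all rows at once, so the powers are
Cauchy and the limit does not depend on the row. -/
lemma exists_tendsto_pow (hs : M.ReachesUnderAllThresholds s₁) :
    ∃ w : S → ℝ, ∀ i j, Tendsto (fun n => (M.transitionMatrix ^ n) i j) atTop (𝓝 (w j)) := by
  obtain ⟨N, hN⟩ := exists_pow_pos hs
  have : Nonempty S := ⟨s₁⟩
  obtain ⟨i₀, hi₀⟩ := Finite.exists_min fun i => (M.transitionMatrix ^ (N : ℕ)) i s₁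
  have hclose : ∀ j, ∀ ε > 0, ∃ n₀ : ℕ, ∀ m ≥ n₀, ∀ n ≥ n₀, ∀ i i',
      |(M.transitionMatrix ^ m) i j - (M.transitionMatrix ^ n) i' j| < ε := by
    intro j ε hε
    have hδ1 : (M.transitionMatrix ^ (N : ℕ)) i₀ s₁ ≤ 1 :=
      Matrix.le_one_of_mem_rowStochastic (pow_mem M.transitionMatrix_mem N)
    obtain ⟨k, hk⟩ := exists_pow_lt_of_lt_one hε
      (show 1 - (M.transitionMatrix ^ (N : ℕ)) i₀ s₁ < 1 by linarith [hN i₀])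
    obtain ⟨a, b, hab, h⟩ := exists_interval hi₀ j k
    refine ⟨N * k, fun m hm n hn i i' => ?_⟩
    have h1 := h m hm i
    have h2 := h n hn i'
    rw [abs_lt]
    constructor <;> linarith
  have hlim : ∀ j, ∃ w, Tendsto (fun n => (M.transitionMatrix ^ n) s₁ j) atTop (𝓝 w) := by
    intro j
    refine cauchySeq_tendsto_of_complete (Metric.cauchySeq_iff.2 fun ε hε => ?_)
    obtain ⟨n₀, h⟩ := hclose j ε hε
    exact ⟨n₀, fun m hm n hn => h m hm n hn s₁ s₁⟩
  choose w hw using hlim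
  refine ⟨w, fun i j => ?_⟩
  have h0 : Tendsto (fun n => (M.transitionMatrix ^ n) i j - (M.transitionMatrix ^ n) s₁ j) atTop
      (𝓝 0) := by
    refine Metric.tendsto_atTop.2 fun ε hε => ?_
    obtain ⟨n₀, h⟩ := hclose j ε hε
    exact ⟨n₀, fun n hn => by simpa [Real.dist_eq] using h n hn n hn i s₁⟩
  simpa using h0.add (hw j)

/-- Long after a query, the least expected loss does not depend on the state that was seen. -/
lemma exists_tendsto_optimalLoss (hs : M.ReachesUnderAllThresholds s₁) :
    ∃ l : ℝ, ∀ i, Tendsto (M.optimalLoss i) atTop (𝓝 l) := by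
  obtain ⟨w, hw⟩ := exists_tendsto_pow hs
  have : Nonempty S := ⟨s₁⟩
  refine ⟨Finset.univ.inf' Finset.univ_nonempty fun k => ∑ j, w j * M.loss j k, fun i => ?_⟩
  have h1 : M.optimalLoss i = fun n =>
      Finset.univ.inf' Finset.univ_nonempty fun k => M.predictionLoss i n k := by
    ext n
    rw [Finset.inf'_univ_eq_ciInf]
    rfl
  rw [h1]
  exact Tendsto.finset_inf'_nhds_apply Finset.univ_nonempty fun k _ =>
    tendsto_finsetSum _ fun j _ => (hw i j).mul_const _

lemma totalCost_queryOncePolicy {κ : S → ℕ → S} (hκ : M.IsOptimalPrediction κ) (T : ℕ)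
    (H : List (Slot S)) (i : S) (n : ℕ) (hH : lastQuery H = some (i, n)) :
    ∑ x, (M.transitionMatrix ^ n) i x * M.totalCost (queryOncePolicy κ) T H x =
      ∑ k ∈ Finset.range T, M.optimalLoss i (n + k) := by
  induction T generalizing H n with
  | zero => simp [totalCost]
  | succ T ih =>
    have hπ : queryOncePolicy κ H = PMF.pure (some (κ i n)) := by simp [queryOncePolicy, hH]
    rw [M.pow_mean_totalCost_of_predict hπ, hκ.eq,
      ih (Slot.predicted (κ i n) :: H) (n + 1) (by simp [lastQuery, hH]),
      Finset.sum_range_succ', add_comm]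
    simp [add_assoc, add_comm 1]

/-- The single query cost vanishes on average, and Cesàro means of the losses keep their limit. -/
lemma sumAverageCost_queryOncePolicy {κ : S → ℕ → S} (hκ : M.IsOptimalPrediction κ) (ν : PMF S)
    {l : ℝ} (hl : ∀ i, Tendsto (M.optimalLoss i) atTop (𝓝 l)) :
    M.sumAverageCost (queryOncePolicy κ) ν = l := by
  have hstart : ∀ T x, M.totalCost (queryOncePolicy κ) (T + 1) [] x =
      M.queryCost + ∑ k ∈ Finset.range T, M.optimalLoss x (1 + k) := by
    intro T x
    have hπ : queryOncePolicy κ [] = PMF.pure none := rfl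
    have h := M.pow_mean_totalCost_of_query hπ T x 0
    rwa [pow_zero_mean, pow_zero_mean, totalCost_queryOncePolicy hκ T [Slot.queried x] x 1 rfl]
      at h
  have havg : M.averageCost (queryOncePolicy κ) ν = fun T : ℕ => ∑ x, (ν x).toReal *
      (M.queryCost * (1 / (T : ℝ)) +
        (T : ℝ)⁻¹ * ∑ k ∈ Finset.range T, M.optimalLoss x (1 + k)) := by
    ext T
    rw [averageCost, sum_expectedCost, Finset.mul_sum]
    refine Finset.sum_congr rfl fun x _ => ?_
    rw [hstart]
    ring
  refine Tendsto.limsup_eq ?_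
  have hlim : ∑ x, (ν x).toReal * (M.queryCost * 0 + l) = l := by
    rw [← Finset.sum_mul, PMF.sum_toReal]
    ring
  rw [havg]
  refine Eq.subst (motive := fun y => Tendsto _ _ (𝓝 y)) hlim
    (tendsto_finsetSum _ fun x _ => Tendsto.const_mul _ ?_)
  refine (tendsto_one_div_atTop_nhds_zero_nat.const_mul _).add (Tendsto.cesaro ?_)
  exact (hl x).comp (tendsto_add_atTop_nat 1 |>.congr fun k => add_comm k 1)

/-- For a cost rate below the limiting loss, the relative costs of stages grow linearly. -/
lemma exists_linear_growth {l γ : ℝ} (hl : ∀ i, Tendsto (M.optimalLoss i) atTop (𝓝 l))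
    (hγ : γ < l) : ∃ ε > 0, ∃ B ≥ 0, ∀ γ' ≤ γ, ∀ i (m : ℕ+),
      ε * (m : ℕ) - B ≤ M.stageCost i m - γ' * (m : ℕ) := by
  obtain ⟨N, hN⟩ : ∃ N, ∀ n ≥ N, ∀ i, γ + (l - γ) / 2 < M.optimalLoss i n :=
    eventually_atTop.1 (eventually_all.2 fun i => (hl i).eventually (lt_mem_nhds (by linarith)))
  have hε : 0 < (l - γ) / 2 := by linarith
  set ε := (l - γ) / 2
  -- This constant pays for the initial slots, where losses are only known to be nonnegative; later
  -- each slot gains at least `ε`.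
  have hB : 0 ≤ (ε + |γ|) * (N + 1) := by positivity
  refine ⟨ε, hε, (ε + |γ|) * (N + 1), hB, fun γ' hγ' i m => ?_⟩
  have key : ∀ n : ℕ, ε * n - (ε + |γ|) * (N + 1) ≤
      ∑ k ∈ Finset.Ico 1 n, M.optimalLoss i k - γ * n := by
    intro n
    induction n with
    | zero => simpa using hB
    | succ n ih =>
      rcases lt_or_ge n (N + 1) with hn | hn
      · have h1 : ((n + 1 : ℕ) : ℝ) ≤ N + 1 := by exact_mod_cast hn
        have h2 : 0 ≤ ∑ k ∈ Finset.Ico 1 (n + 1), M.optimalLoss i k :=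
          Finset.sum_nonneg fun k _ => M.optimalLoss_nonneg i k
        have h3 : (ε + γ) * (n + 1 : ℕ) ≤ (ε + |γ|) * (N + 1) :=
          mul_le_mul (by linarith [le_abs_self γ]) h1 (by positivity) (by positivity)
        linarith
      · rw [Finset.sum_Ico_succ_top (by omega)]
        have := hN n (by omega) i
        push_cast
        linarith
  have h1 := key m
  have h2 : γ' * (m : ℕ) ≤ γ * (m : ℕ) := mul_le_mul_of_nonneg_right hγ' (by positivity)
  have h3 := M.queryCost.coe_nonneg
  rw [stageCost]
  linarith

lemma exists_stageValue_min {l γ : ℝ} (hl : ∀ i, Tendsto (M.optimalLoss i) atTop (𝓝 l))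
    (hγ : γ < l) (h : S → ℝ) (i : S) :
    ∃ m : ℕ+, ∀ m' : ℕ+, M.stageValue γ h i m ≤ M.stageValue γ h i m' := by
  obtain ⟨ε, hε, B, -, hB⟩ := exists_linear_growth hl hγ
  obtain ⟨C, hC⟩ := (Set.finite_range h).bddBelow
  have hlim : Tendsto (fun n : ℕ => M.stageValue γ h i n.succPNat) cofinite atTop := by
    rw [Nat.cofinite_eq_atTop]
    refine tendsto_atTop_mono (f := fun n : ℕ => ε * n + (C - B)) (fun n => ?_)
      (tendsto_atTop_add_const_right _ _ (tendsto_natCast_atTop_atTop.const_mul_atTop hε))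
    have h1 := hB γ le_rfl i n.succPNat
    have h2 := M.le_pow_mean (n.succPNat : ℕ) i fun j => hC ⟨j, rfl⟩
    have h3 : ε * n ≤ ε * (n.succPNat : ℕ) :=
      mul_le_mul_of_nonneg_left (by simp) hε.le
    rw [stageValue]
    linarith
  obtain ⟨n, hn⟩ := hlim.exists_forall_le
  exact ⟨n.succPNat, fun m' => by simpa using hn m'.natPred⟩

lemma exists_improvement {l γ : ℝ} (hl : ∀ i, Tendsto (M.optimalLoss i) atTop (𝓝 l))
    (hγ : γ < l) (h : S → ℝ) (μ : S → ℕ+) : ∃ μ', M.IsImprovement γ h μ μ' := by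
  suffices ∀ i, ∃ m : ℕ+, (∀ m', M.stageValue γ h i m ≤ M.stageValue γ h i m') ∧
      ((∀ m', M.stageValue γ h i (μ i) ≤ M.stageValue γ h i m') → m = μ i) by
    choose μ' hμ' using this
    exact ⟨μ', hμ'⟩
  intro i
  by_cases hi : ∀ m', M.stageValue γ h i (μ i) ≤ M.stageValue γ h i m'
  · exact ⟨μ i, hi, fun _ => rfl⟩
  · obtain ⟨m, hm⟩ := exists_stageValue_min hl hγ h i
    exact ⟨m, hm, fun h' => absurd h' hi⟩

end Ergodic

end MonitoringSystem

namespace MonitoringSystem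

variable {S : Type*} [Fintype S] [DecidableEq S]

/-! ### A bound that is uniform in the thresholds -/

/-- If `s₁` can be reached along edges of weight at least `δ`, then subharmonic functions up to an
error `a` are bounded by a multiple of `a`, which depends on the edges only. -/
lemma exists_bound_of_edges (s₁ : S) {δ : ℝ} (hδ : 0 < δ) {E : S → S → Prop}
    (hE : ∀ i, Relation.ReflTransGen E i s₁) :
    ∃ K ≥ 0, ∀ (Q : S → S → ℝ) (a : ℝ) (g : S → ℝ), (∀ i j, 0 ≤ Q i j) → (∀ i, ∑ j, Q i j = 1) →
      (∀ i j, E i j → δ ≤ Q i j) → 0 ≤ a → g s₁ ≤ 0 → (∀ i, g i ≤ a + ∑ j, Q i j * g j) →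
      ∀ i, g i ≤ K * a := by
  -- A value within `e` of the upper bound `G` forces each `E`-successor within `(a + e) / δ` of it;
  -- this is followed along a path to `s₁`.
  have key : ∀ i, ∃ K ≥ 0, ∀ (Q : S → S → ℝ) (a e G : ℝ) (g : S → ℝ), (∀ i j, 0 ≤ Q i j) →
      (∀ i, ∑ j, Q i j = 1) → (∀ i j, E i j → δ ≤ Q i j) → 0 ≤ a → 0 ≤ e →
      (∀ i, g i ≤ a + ∑ j, Q i j * g j) → (∀ j, g j ≤ G) → G - e ≤ g i →
      G ≤ g s₁ + K * (a + e) := by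
    intro i
    induction hE i using Relation.ReflTransGen.head_induction_on with
    | refl => exact ⟨1, zero_le_one, fun Q a e G g _ _ _ ha _ _ _ h => by linarith⟩
    | @head i j hij _ ih =>
      obtain ⟨K, hK, hb⟩ := ih
      refine ⟨K * (1 + 1 / δ), by positivity, fun Q a e G g hQ hs hQE ha he hg hG h => ?_⟩
      have h1 : δ * (G - g j) ≤ a + e := by
        have h2 : Q i j * (G - g j) ≤ ∑ x, Q i x * (G - g x) :=
          Finset.single_le_sum (f := fun x => Q i x * (G - g x))
            (fun x _ => mul_nonneg (hQ i x) (sub_nonneg.2 (hG x))) (Finset.mem_univ j)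
        simp_rw [mul_sub, Finset.sum_sub_distrib, ← Finset.sum_mul, hs] at h2
        have h3 := mul_le_mul_of_nonneg_right (hQE i j hij) (sub_nonneg.2 (hG j))
        linarith [hg i]
      have h4 : G - (a + e) / δ ≤ g j := by
        have : G - g j ≤ (a + e) / δ := by rwa [le_div_iff₀' hδ]
        linarith
      refine (hb Q a ((a + e) / δ) G g hQ hs hQE ha (by positivity) hg hG h4).trans ?_
      have h5 : K * (a + (a + e) / δ) ≤ K * ((a + e) + (a + e) / δ) :=
        mul_le_mul_of_nonneg_left (by linarith) hK
      have h6 : K * (1 + 1 / δ) * (a + e) = K * ((a + e) + (a + e) / δ) := by ring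
      linarith
  choose K hK hb using key
  -- The sum covers every possible maximiser of `g`, which is not known in advance.
  refine ⟨∑ i, K i, Finset.sum_nonneg fun i _ => hK i, fun Q a g hQ hs hQE ha h1 hg i => ?_⟩
  have : Nonempty S := ⟨i⟩
  obtain ⟨i₀, h₀⟩ := Finite.exists_max g
  have h2 := hb i₀ Q a 0 (g i₀) g hQ hs hQE ha le_rfl hg h₀ (by simp)
  have h3 : K i₀ * a ≤ (∑ i, K i) * a :=
    mul_le_mul_of_nonneg_right (Finset.single_le_sum (fun i _ => hK i) (Finset.mem_univ i₀)) ha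
  rw [add_zero] at h2
  linarith [h₀ i]

variable {M : MonitoringSystem S} {s₁ : S}

/-- Under every threshold policy, the queried states reach `s₁` along edges whose probability is
bounded away from zero, uniformly in the thresholds. -/
lemma exists_uniform_edges (hs : M.ReachesUnderAllThresholds s₁) : ∃ δ > 0, ∀ (μ : S → ℕ+) (i : S),
    Relation.ReflTransGen (fun a b => δ ≤ (M.transitionMatrix ^ (μ a : ℕ)) a b) i s₁ := by
  obtain ⟨N, hN⟩ := exists_pow_pos hs
  have : Nonempty S := ⟨s₁⟩
  -- `δ` will be the least positive entry among the powers up to `N`; zero entries are replaced by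
  -- `1`.
  obtain ⟨q₀, hq₀⟩ := Finite.exists_min fun q : Fin ((N : ℕ) + 1) × S × S =>
    if 0 < (M.transitionMatrix ^ (q.1 : ℕ)) q.2.1 q.2.2 then
      (M.transitionMatrix ^ (q.1 : ℕ)) q.2.1 q.2.2 else 1
  obtain ⟨δ, hδ, h⟩ : ∃ δ > 0, ∀ n ≤ (N : ℕ), ∀ i j, 0 < (M.transitionMatrix ^ n) i j →
      δ ≤ (M.transitionMatrix ^ n) i j := by
    refine ⟨_, ?_, fun n hn i j hij => (hq₀ (⟨n, by omega⟩, i, j)).trans_eq (if_pos hij)⟩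
    split_ifs with h
    exacts [h, one_pos]
  refine ⟨δ, hδ, fun μ i => ?_⟩
  -- Paths are taken for thresholds truncated at `N`. Where truncation matters, `s₁` is reached
  -- directly, since that column of the `N`-th power is at least `δ`.
  induction hs (fun i => min (μ i) N) i using Relation.ReflTransGen.head_induction_on with
  | refl => exact .refl
  | @head a b hab _ ih =>
    rcases le_total (μ a) N with hle | hle
    · rw [min_eq_left hle] at hab
      exact .head (h _ (by exact_mod_cast hle) a b hab) ih
    · refine .single ?_
      obtain ⟨r, hr⟩ := Nat.exists_eq_add_of_le' (show (N : ℕ) ≤ μ a by exact_mod_cast hle)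
      rw [hr, pow_add_apply]
      exact M.le_pow_mean r a fun x => h N le_rfl x s₁ (hN x)

/-- The infinitely many thresholds give only finitely many edge relations on `S`, so the largest
constant serves for all. -/
lemma exists_uniform_bound (hs : M.ReachesUnderAllThresholds s₁) : ∃ K ≥ 0, ∀ (μ : S → ℕ+) (a : ℝ)
    (g : S → ℝ), 0 ≤ a → g s₁ ≤ 0 →
      (∀ i, g i ≤ a + ∑ j, (M.transitionMatrix ^ (μ i : ℕ)) i j * g j) → ∀ i, g i ≤ K * a := by
  obtain ⟨δ, hδ, hE⟩ := exists_uniform_edges hs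
  choose K hK hb using fun E : {E : S → S → Prop // ∀ i, Relation.ReflTransGen E i s₁} =>
    exists_bound_of_edges s₁ hδ E.2
  obtain ⟨C, hC⟩ := (Set.finite_range K).bddAbove
  refine ⟨max C 0, le_max_right _ _, fun μ a g ha h1 hg i => ?_⟩
  refine (hb ⟨_, hE μ⟩ (fun i j => (M.transitionMatrix ^ (μ i : ℕ)) i j) a g
    (fun i j => M.pow_apply_nonneg _ i j) (fun i => M.pow_sum_row _ i) (fun _ _ h => h) ha h1 hg
    i).trans ?_
  exact mul_le_mul_of_nonneg_right ((hC ⟨_, rfl⟩).trans (le_max_left _ _)) ha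

/-! ### Runs of policy iteration -/

lemma rate_nonneg {μ : S → ℕ+} {γ : ℝ} {h : S → ℝ} (hV : M.SolvesRelativeCost s₁ μ γ h) :
    0 ≤ γ := by
  have : Nonempty S := ⟨s₁⟩
  refine rate_nonneg_of_superharmonic (M := M) (μ := μ) (g := h) fun i => ?_
  have h1 := hV.1 i
  have h2 : 0 ≤ M.stageCost i (μ i) := add_nonneg M.queryCost.coe_nonneg
    (Finset.sum_nonneg fun n _ => M.optimalLoss_nonneg i n)
  rw [stageValue] at h1
  linarith

section Run

variable {u : ℕ → S → ℕ+} {γ : ℕ → ℝ} {h : ℕ → S → ℝ}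

lemma rate_antitone (hV : ∀ k, M.SolvesRelativeCost s₁ (u k) (γ k) (h k))
    (hI : ∀ k, M.IsImprovement (γ k) (h k) (u k) (u (k + 1))) : Antitone γ :=
  antitone_nat_of_succ_le fun k => rate_le ((hI k).stageValue_le (hV k)) (hV (k + 1))

/-- The relative costs along a run of policy iteration are bounded, and so are the thresholds. -/
lemma exists_threshold_le (hs : M.ReachesUnderAllThresholds s₁) {l : ℝ}
    (hl : ∀ i, Tendsto (M.optimalLoss i) atTop (𝓝 l)) (hγ : γ 0 < l)
    (hV : ∀ k, M.SolvesRelativeCost s₁ (u k) (γ k) (h k))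
    (hI : ∀ k, M.IsImprovement (γ k) (h k) (u k) (u (k + 1))) :
    ∃ R : ℝ, ∀ k i, (u (k + 1) i : ℕ) ≤ R := by
  obtain ⟨ε, hε, B, hB0, hB⟩ := exists_linear_growth hl hγ
  obtain ⟨K, hK, hbound⟩ := exists_uniform_bound hs
  obtain ⟨U, hU⟩ := (Set.finite_range (h 0)).bddAbove
  have hanti := rate_antitone hV hI
  have hγ0 : ∀ k, 0 ≤ γ k := fun k => rate_nonneg (hV k)
  have hlow : ∀ k i, -(K * B) ≤ h k i := by
    intro k i
    have := hbound (u k) B (fun j => -h k j) hB0 (by simp [(hV k).2]) (fun i => by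
      have h1 := (hV k).1 i
      have h2 := hB (γ k) (hanti (Nat.zero_le k)) i (u k i)
      have h3 : 0 ≤ ε * (u k i : ℕ) := by positivity
      rw [stageValue] at h1
      simp only [mul_neg, Finset.sum_neg_distrib]
      linarith) i
    linarith
  obtain ⟨A, hA⟩ : ∃ A : ℝ, A = B + K * B + M.queryCost := ⟨_, rfl⟩
  have hA0 : 0 ≤ A := by rw [hA]; positivity
  -- The minimising stage is compared with the stage of length `1`, whose value is at most the query
  -- cost plus the maximum of `h k`.
  have hthr : ∀ k W, (∀ i, h k i + A ≤ W) → ∀ i, ε * (u (k + 1) i : ℕ) ≤ W := by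
    intro k W hW i
    have h1 := (hI k i).1 1
    have h2 := hB (γ k) (hanti (Nat.zero_le k)) i (u (k + 1) i)
    have h3 := M.le_pow_mean (u (k + 1) i) i (hlow k)
    have h4 := M.pow_mean_le (1 : ℕ+) i (f := h k) (C := W - A)
      fun j => by linarith [hW j]
    have h6 := hγ0 k
    simp only [stageValue, stageCost, PNat.one_coe, Finset.Ico_self, Finset.sum_empty,
      Nat.cast_one, mul_one, add_zero] at h1 h4
    rw [stageCost] at h2
    linarith
  -- One step multiplies the bound by at most `1 + K / ε * (γ k - γ (k + 1))`; replacing this by an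
  -- exponential makes the rate drops telescope, and their sum is at most `γ 0`.
  have hupp : ∀ k i, h k i + A ≤
      (U + A) * Real.exp (K / ε * (γ 0 - γ k)) := by
    intro k
    induction k with
    | zero => intro i; simpa using hU ⟨i, rfl⟩
    | succ k ih =>
      intro i
      set W := (U + A) * Real.exp (K / ε * (γ 0 - γ k)) with hWdef
      have hW0 : 0 ≤ W := by
        have := ih s₁
        rw [(hV k).2] at this
        linarith
      have hΔ : 0 ≤ γ k - γ (k + 1) := sub_nonneg.2 (hanti (Nat.le_succ k))
      have h1 := hbound (u (k + 1)) ((γ k - γ (k + 1)) * (W / ε)) (fun j => h (k + 1) j - h k j)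
        (by positivity) (by simp [(hV _).2]) (fun i => by
          have h2 := sub_superharmonic ((hI k).stageValue_le (hV k))
            (fun i => ((hV (k + 1)).1 i).le) i
          have h3 : (u (k + 1) i : ℕ) ≤ W / ε := by
            rw [le_div_iff₀' hε]
            exact hthr k W ih i
          have h4 := mul_le_mul_of_nonneg_left h3 hΔ
          simp only [mul_sub, Finset.sum_sub_distrib] at h2 ⊢
          linarith) i
      have h5 : K * ((γ k - γ (k + 1)) * (W / ε)) = W * (K / ε * (γ k - γ (k + 1))) := by ring
      have h6 : W * (K / ε * (γ k - γ (k + 1)) + 1) ≤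
          W * Real.exp (K / ε * (γ k - γ (k + 1))) :=
        mul_le_mul_of_nonneg_left (Real.add_one_le_exp _) hW0
      have h7 : W * Real.exp (K / ε * (γ k - γ (k + 1))) =
          (U + A) * Real.exp (K / ε * (γ 0 - γ (k + 1))) := by
        rw [hWdef, mul_assoc, ← Real.exp_add]
        congr 2
        ring
      linarith [ih i]
  refine ⟨(U + A) * Real.exp (K / ε * γ 0) / ε, fun k i => ?_⟩
  rw [le_div_iff₀' hε]
  refine (hthr k _ (hupp k) i).trans ?_
  refine mul_le_mul_of_nonneg_left (Real.exp_le_exp.2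
    (mul_le_mul_of_nonneg_left (by linarith [hγ0 k]) (by positivity))) ?_
  have h1 := hU ⟨s₁, rfl⟩
  rw [(hV 0).2] at h1
  linarith

/-- Policy iteration that visits the same thresholds twice has stopped. -/
lemma stops_of_repetition (hs : M.ReachesUnderAllThresholds s₁)
    (hV : ∀ k, M.SolvesRelativeCost s₁ (u k) (γ k) (h k))
    (hI : ∀ k, M.IsImprovement (γ k) (h k) (u k) (u (k + 1))) {a b : ℕ} (hab : a < b)
    (hu : u a = u b) : M.IsImprovement (γ a) (h a) (u a) (u a) := by
  have hanti := rate_antitone hV hI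
  obtain ⟨hγab, hhab⟩ := solution_unique hs (hV a) (hu ▸ hV b)
  -- Equal thresholds have equal rates, so the antitone rates are constant from `a` to `b`. At
  -- constant rate the relative costs decrease pointwise, and their return to `h a` makes them
  -- constant too.
  have hconst : ∀ k, a ≤ k → k ≤ b → γ k = γ a := fun k hk hk' =>
    le_antisymm (hanti hk) (hγab ▸ hanti hk')
  have hstep : ∀ k, a ≤ k → k < b → ∀ i, h (k + 1) i ≤ h k i := by
    intro k hk hk' i
    have h1 := hV (k + 1)
    rw [hconst (k + 1) (by omega) hk', ← hconst k hk hk'.le] at h1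
    exact relativeCost_le hs ((hI k).stageValue_le (hV k)) (hV k).2 h1 i
  have hdesc : ∀ k, a + 1 ≤ k → k ≤ b → ∀ i, h k i ≤ h (a + 1) i := by
    intro k hk
    induction k, hk using Nat.le_induction with
    | base => exact fun _ i => le_rfl
    | succ k hk ih => exact fun hk' i => (hstep k (by omega) hk' i).trans (ih (by omega) i)
  have heq : h (a + 1) = h a := funext fun i => le_antisymm (hstep a le_rfl hab i)
    (hhab ▸ hdesc b hab le_rfl i)
  intro i
  refine ⟨fun m => ?_, fun _ => rfl⟩
  have h1 := (hV (a + 1)).1 i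
  rw [hconst (a + 1) (by omega) hab, heq] at h1
  rw [← (hV a).1 i, h1]
  exact (hI a i).1 m

/-- Pigeonhole on the bounded thresholds gives a fixed point; the rule that keeps minimising
thresholds then makes the run constant. -/
lemma exists_isImprovement_self (hs : M.ReachesUnderAllThresholds s₁) {l : ℝ}
    (hl : ∀ i, Tendsto (M.optimalLoss i) atTop (𝓝 l)) (hγ : γ 0 < l)
    (hV : ∀ k, M.SolvesRelativeCost s₁ (u k) (γ k) (h k))
    (hI : ∀ k, M.IsImprovement (γ k) (h k) (u k) (u (k + 1))) :
    ∃ n, M.IsImprovement (γ n) (h n) (u n) (u n) ∧ ∀ k, n ≤ k → u k = u n := by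
  obtain ⟨R, hR⟩ := exists_threshold_le hs hl hγ hV hI
  have hfin : {μ : S → ℕ+ | ∀ i, μ i ∈ Set.Iic (⌊R⌋₊.succPNat)}.Finite :=
    (Set.Finite.pi' fun _ => Set.finite_Iic _)
  have hmem : ∀ k, u (k + 1) ∈ {μ : S → ℕ+ | ∀ i, μ i ∈ Set.Iic (⌊R⌋₊.succPNat)} := by
    intro k i
    rw [Set.mem_Iic, ← PNat.coe_le_coe, Nat.succPNat_coe]
    exact (Nat.le_floor (hR k i)).trans (Nat.le_succ _)
  -- Indices are shifted by one because the bound says nothing about the initial thresholds.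
  obtain ⟨a, b, hab, hu⟩ := hfin.exists_lt_map_eq_of_forall_mem hmem
  have hfix := stops_of_repetition hs hV hI (Nat.succ_lt_succ hab) hu
  refine ⟨a + 1, hfix, fun k hk => ?_⟩
  induction k, hk using Nat.le_induction with
  | base => rfl
  | succ k _ ih =>
    obtain ⟨hγk, hhk⟩ := solution_unique hs (hV k) (ih ▸ hV (a + 1))
    have h1 := hI k
    rw [ih, hγk, hhk] at h1
    exact funext fun i => (h1 i).2 (hfix i).1

end Run

end MonitoringSystem
theorem theorem2 {S : Type*} [Fintype S] [DecidableEq S] (M : MonitoringSystem S) (s₁ : S)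
    (ν : PMF S) (κ : S → ℕ → S) (hκ : M.IsOptimalPrediction κ) :
    -- solving the relative-cost equations with the optimal cost rate gives optimal thresholds
    (∀ (μ : S → ℕ+) (h : S → ℝ), M.SolvesRelativeCost s₁ μ (M.optimalCost ν) h →
      M.IsOptimal ν (MonitoringSystem.thresholdPolicy κ μ)) ∧
    -- policy evaluation computes the sum average cost of the threshold policy
    (∀ (μ : S → ℕ+) (γ : ℝ) (h : S → ℝ), M.SolvesRelativeCost s₁ μ γ h →
      Tendsto (M.averageCost (MonitoringSystem.thresholdPolicy κ μ) ν) atTop (𝓝 γ)) ∧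
    -- where policy iteration stops, it has solved the equations with the optimal cost rate
    (∀ (μ : S → ℕ+) (γ : ℝ) (h : S → ℝ), M.SolvesRelativeCost s₁ μ γ h →
      M.IsImprovement γ h μ μ →
      γ = M.optimalCost ν ∧ M.IsOptimal ν (MonitoringSystem.thresholdPolicy κ μ)) ∧
    -- policy iteration is well defined, and it stops after finitely many steps
    (M.ReachesUnderAllThresholds s₁ →
      (∀ μ : S → ℕ+, ∃! p : ℝ × (S → ℝ), M.SolvesRelativeCost s₁ μ p.1 p.2) ∧
      (∀ μ μ' : S → ℕ+, M.PolicyIterationStep s₁ μ μ' →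
        M.sumAverageCost (MonitoringSystem.thresholdPolicy κ μ') ν ≤
          M.sumAverageCost (MonitoringSystem.thresholdPolicy κ μ) ν) ∧
      (∀ μ : S → ℕ+,
        M.sumAverageCost (MonitoringSystem.thresholdPolicy κ μ) ν <
          M.sumAverageCost (MonitoringSystem.queryOncePolicy κ) ν →
        ∃ μ' : S → ℕ+, M.PolicyIterationStep s₁ μ μ') ∧
      (∀ u : ℕ → S → ℕ+,
        M.sumAverageCost (MonitoringSystem.thresholdPolicy κ (u 0)) ν <
          M.sumAverageCost (MonitoringSystem.queryOncePolicy κ) ν →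
        (∀ k : ℕ, M.PolicyIterationStep s₁ (u k) (u (k + 1))) →
        ∃ n : ℕ, (∀ k : ℕ, n ≤ k → u k = u n) ∧
          (∃ h : S → ℝ, M.SolvesRelativeCost s₁ (u n) (M.optimalCost ν) h ∧
            M.IsImprovement (M.optimalCost ν) h (u n) (u n)) ∧
          M.IsOptimal ν (MonitoringSystem.thresholdPolicy κ (u n)))) := by
  refine ⟨fun μ h hV => M.isOptimal_of_tendsto (M.tendsto_averageCost_thresholdPolicy hκ ν hV),
    fun μ γ h hV => M.tendsto_averageCost_thresholdPolicy hκ ν hV,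
    fun μ γ h hV hI => M.optimal_of_isImprovement_self hκ ν hV hI, fun hs => ?_⟩
  obtain ⟨l, hl⟩ := MonitoringSystem.exists_tendsto_optimalLoss hs
  -- The comparison with querying once thus becomes `γ < l`, the condition for linear growth of
  -- stage values.
  rw [MonitoringSystem.sumAverageCost_queryOncePolicy hκ ν hl]
  refine ⟨fun μ => ?_, ?_, fun μ hμ => ?_, fun u hu hstep => ?_⟩
  · obtain ⟨γ, h, hV⟩ := MonitoringSystem.exists_solution hs μ
    refine ⟨(γ, h), hV, ?_⟩
    rintro ⟨γ', h'⟩ hV'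
    obtain ⟨rfl, rfl⟩ := MonitoringSystem.solution_unique hs hV' hV
    rfl
  · rintro μ μ' ⟨γ, h, hV, hI⟩
    obtain ⟨γ', h', hV'⟩ := MonitoringSystem.exists_solution hs μ'
    rw [M.sumAverageCost_thresholdPolicy hκ ν hV, M.sumAverageCost_thresholdPolicy hκ ν hV']
    exact MonitoringSystem.rate_le (hI.stageValue_le hV) hV'
  · obtain ⟨γ, h, hV⟩ := MonitoringSystem.exists_solution hs μ
    rw [M.sumAverageCost_thresholdPolicy hκ ν hV] at hμ
    obtain ⟨μ', hμ'⟩ := MonitoringSystem.exists_improvement hl hμ h μ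
    exact ⟨μ', γ, h, hV, hμ'⟩
  · choose γ h hV hI using hstep
    rw [M.sumAverageCost_thresholdPolicy hκ ν (hV 0)] at hu
    obtain ⟨n, hn, hconst⟩ := MonitoringSystem.exists_isImprovement_self hs hl hu hV hI
    obtain ⟨hγ, hopt⟩ := M.optimal_of_isImprovement_self hκ ν (hV n) hn
    exact ⟨n, hconst, ⟨h n, hγ ▸ hV n, hγ ▸ hn⟩, hopt⟩
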